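/- All graphs are finite, simple, undirected, with non-empty vertex set. Formulas are first-order formulas in adjacency $\sim$ and equality $=$, with connectives $\neg,\wedge,\vee$; *counting logic* additionally has the quantifiers $\exists^m x$ ("there are at least $m$ vertices $x$ such that"), *standard logic* has only $\exists,\forall$. The depth of a formula is its maximum number of nested quantifiers (each $\exists^m$ counts as one), its width is the number of distinct variables occurring in it (variables may be requantified). A sentence defines $G$ if it is true on $G$ and false on every graph not isomorphic to $G$. Let $W(G)$ be the minimum width of a sentence of standard logic defining $G$, and let $D^{l}(G)$ be the minimum depth of a sentence of standard logic of width at most $l$ defining $G$ ($\infty$ if there is none); $W_\#(G)$ and $D_\#^{l}(G)$ are the same parameters for counting logic. For $k\ge 2$, the $k$-dimensional Weisfeiler–Lehman algorithm on graphs $G,H$ gives a $k$-tuple $\bar u$ of vertices of one of the graphs the initial color $$\mathrm{WL}_k^0(\bar u)=\bigl(\{(i,j): u_i=u_j\},\ \{(i,j): u_i\sim u_j\}\bigr),$$ and in round $i\ge1$ the color $$\mathrm{WL}_k^{i}(\bar u)=\Bigl(\mathrm{WL}_k^{i-1}(\bar u),\ \{\!\!\{(\mathrm{WL}_k^{i-1}(\bar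 u^{1,w}),\dots,\mathrm{WL}_k^{i-1}(\bar u^{k,w})) : w\}\!\!\}\Bigr),$$ where $w$ runs over the vertices of the graph containing $\bar u$, and $\bar u^{j,w}$ is $\bar u$ with its $j$-th entry replaced by $w$. The $r$-round algorithm reports $G\cong H$ if and only if $\{\!\!\{\mathrm{WL}_k^r(\bar u):\bar u\in V(G)^k\}\!\!\}=\{\!\!\{\mathrm{WL}_k^r(\bar v):\bar v\in V(H)^k\}\!\!\}$. In the count-free version all these multisets are replaced by sets. For $k=1$ the algorithm is color refinement: all vertices have the same initial color, in each round the new color of $u$ is the pair of its preceding color and the multiset of the preceding colors of its neighbors, and after $r$ rounds $G\cong H$ is reported if and only if the multisets of vertex colors of $G$ and $H$ coincide. The $r$-round algorithm *works correctly for $G$* if for every graph $H$ (of any order) it reports $G\cong H$ exactly when $G\cong H$. **Theorem.** Let $G$ be a graph and $r\ge0$. 1. Let $k\ge1$. If $k\ge W_\#(G)-1$ and $r\ge D_\#^{k+1}(G)-1$, then the $r$-round $k$-dimensional Weisfeiler–Lehman algorithm works correctly for $G$. Conversely, if it works correctly for $G$, then $k\ge W_\#(G)-1$ and $r\ge D_\#^{k+1}(G)-k$.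 2. Let $k\ge2$. If $k\ge W(G)-1$ and $r\ge D^{k+1}(G)-1$, then the count-free $r$-round $k$-dimensional Weisfeiler–Lehman algorithm works correctly for $G$. Conversely, if it works correctly for $G$, then $k\ge W(G)-1$ and $r\ge D^{k+1}(G)-k$. -/

import Mathlib

namespace WLLogic

universe u

/-! ### First-order formulas about graphs, with counting quantifiers -/

/-- Formulas over the vocabulary of adjacency and equality, with variables named by natural
numbers (which may be requantified); `exAtLeast m i φ` is the counting quantifier `∃^m x_i φ`. -/
inductive Formula : Type
  | adj (i j : ℕ) : Formula
  | eq (i j : ℕ) : Formula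
  | neg (φ : Formula) : Formula
  | and (φ ψ : Formula) : Formula
  | or (φ ψ : Formula) : Formula
  | ex (i : ℕ) (φ : Formula) : Formula
  | all (i : ℕ) (φ : Formula) : Formula
  | exAtLeast (m i : ℕ) (φ : Formula) : Formula

namespace Formula

/-- The variables that occur in a formula, including those that occur only at a quantifier. -/
def vars : Formula → Finset ℕ
  | adj i j => {i, j}
  | eq i j => {i, j}
  | neg φ => φ.vars
  | and φ ψ => φ.vars ∪ ψ.vars
  | or φ ψ => φ.vars ∪ ψ.vars
  | ex i φ => insert i φ.vars
  | all i φ => insert i φ.vars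
  | exAtLeast _ i φ => insert i φ.vars

/-- The free variables of a formula. -/
def freeVars : Formula → Finset ℕ
  | adj i j => {i, j}
  | eq i j => {i, j}
  | neg φ => φ.freeVars
  | and φ ψ => φ.freeVars ∪ ψ.freeVars
  | or φ ψ => φ.freeVars ∪ ψ.freeVars
  | ex i φ => φ.freeVars.erase i
  | all i φ => φ.freeVars.erase i
  | exAtLeast _ i φ => φ.freeVars.erase i

/-- The quantifier depth; a counting quantifier contributes 1. -/
def depth : Formula → ℕ
  | adj _ _ => 0
  | eq _ _ => 0
  | neg φ => φ.depth
  | and φ ψ => max φ.depth ψ.depth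
  | or φ ψ => max φ.depth ψ.depth
  | ex _ φ => φ.depth + 1
  | all _ φ => φ.depth + 1
  | exAtLeast _ _ φ => φ.depth + 1

/-- The width: the number of different variables used in the formula. -/
def width (φ : Formula) : ℕ := φ.vars.card

/-- The formula contains no counting quantifier. -/
def CountFree : Formula → Prop
  | adj _ _ => True
  | eq _ _ => True
  | neg φ => φ.CountFree
  | and φ ψ => φ.CountFree ∧ ψ.CountFree
  | or φ ψ => φ.CountFree ∧ ψ.CountFree
  | ex _ φ => φ.CountFree
  | all _ φ => φ.CountFree
  | exAtLeast _ _ _ => False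

/-- A sentence is a formula without free variables. -/
def IsSentence (φ : Formula) : Prop := φ.freeVars = ∅

/-- Truth of a formula in the graph `G` under an assignment of vertices to the variables. -/
def Holds {V : Type u} (G : SimpleGraph V) : Formula → (ℕ → V) → Prop
  | adj i j, s => G.Adj (s i) (s j)
  | eq i j, s => s i = s j
  | neg φ, s => ¬ Holds G φ s
  | and φ ψ, s => Holds G φ s ∧ Holds G ψ s
  | or φ ψ, s => Holds G φ s ∨ Holds G ψ s
  | ex i φ, s => ∃ w : V, Holds G φ (Function.update s i w)
  | all i φ, s => ∀ w : V, Holds G φ (Function.update s i w)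
  | exAtLeast m i φ, s =>
      ∃ A : Finset V, A.card = m ∧ ∀ w ∈ A, Holds G φ (Function.update s i w)

/-- Truth of a sentence in a graph (for a sentence the assignment is irrelevant). -/
def TrueOn {V : Type u} (φ : Formula) (G : SimpleGraph V) : Prop :=
  ∀ s : ℕ → V, Holds G φ s

/-- The sentence `φ` is true on `G` and false on every finite non-empty graph that is not
isomorphic to `G`. -/
def Defines {V : Type u} (φ : Formula) (G : SimpleGraph V) : Prop :=
  φ.IsSentence ∧ φ.TrueOn G ∧
    ∀ (U : Type u) [Fintype U] [Nonempty U] (H : SimpleGraph U),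
      ¬ Nonempty (G ≃g H) → ¬ φ.TrueOn H

end Formula

/-- Counting logic: all formulas. -/
def countingLogic : Set Formula := Set.univ

/-- Standard first-order logic: the formulas without counting quantifiers. -/
def standardLogic : Set Formula := {φ | φ.CountFree}

/-- The least width of a sentence of the logic `L` that defines `G`. -/
noncomputable def logicalWidth (L : Set Formula) {V : Type u} (G : SimpleGraph V) : ℕ∞ :=
  ⨅ (φ : Formula) (_ : φ ∈ L ∧ φ.Defines G), (φ.width : ℕ∞)

/-- The least quantifier depth of a sentence of the logic `L` that defines `G` and uses at most
`l` variables; it is `⊤` if there is no such sentence. -/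
noncomputable def logicalDepth (L : Set Formula) (l : ℕ) {V : Type u} (G : SimpleGraph V) : ℕ∞ :=
  ⨅ (φ : Formula) (_ : φ ∈ L ∧ φ.width ≤ l ∧ φ.Defines G), (φ.depth : ℕ∞)

/-! ### The Weisfeiler-Lehman algorithm -/

/-- The isomorphism type of a `k`-tuple of vertices. -/
def isoType {k : ℕ} {V : Type u} (G : SimpleGraph V) (x : Fin k → V) :
    Set (Fin k × Fin k) × Set (Fin k × Fin k) :=
  ({p | x p.1 = x p.2}, {p | G.Adj (x p.1) (x p.2)})

/-- The colors of `k`-tuples after `r` rounds. -/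
def WLColor (k : ℕ) : ℕ → Type
  | 0 => Set (Fin k × Fin k) × Set (Fin k × Fin k)
  | r + 1 => WLColor k r × Multiset (Fin k → WLColor k r)

/-- The color of a `k`-tuple after `r` rounds; `Function.update x i w` is the tuple `x` with `w`
substituted for its `i`-th entry. -/
def wlColor {k : ℕ} {V : Type u} [Fintype V] (G : SimpleGraph V) :
    (r : ℕ) → (Fin k → V) → WLColor k r
  | 0, x => isoType G x
  | r + 1, x => (wlColor G r x,
      (Finset.univ : Finset V).val.map fun w => fun i => wlColor G r (Function.update x i w))

/-- The multiset of the colors of all `k`-tuples after `r` rounds. -/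
def wlGraph (k r : ℕ) {V : Type u} [Fintype V] (G : SimpleGraph V) : Multiset (WLColor k r) :=
  (Finset.univ : Finset (Fin k → V)).val.map (wlColor G r)

/-- The colors of `k`-tuples after `r` rounds of the count-free version. -/
def CFColor (k : ℕ) : ℕ → Type
  | 0 => Set (Fin k × Fin k) × Set (Fin k × Fin k)
  | r + 1 => CFColor k r × Set (Fin k → CFColor k r)

/-- The color of a `k`-tuple after `r` rounds of the count-free version. -/
def cfColor {k : ℕ} {V : Type u} (G : SimpleGraph V) : (r : ℕ) → (Fin k → V) → CFColor k r
  | 0, x => isoType G x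
  | r + 1, x => (cfColor G r x,
      Set.range fun w : V => fun i => cfColor G r (Function.update x i w))

/-- The set of the colors of all `k`-tuples after `r` rounds of the count-free version. -/
def cfGraph (k r : ℕ) {V : Type u} (G : SimpleGraph V) : Set (CFColor k r) :=
  Set.range fun x : Fin k → V => cfColor G r x

/-- The colors of vertices after `r` rounds of the color refinement procedure. -/
def CRColor : ℕ → Type
  | 0 => Unit
  | r + 1 => CRColor r × Multiset (CRColor r)

open Classical in
/-- The color of a vertex after `r` rounds of color refinement: the preceding color and the
multiset of the preceding colors of the neighbors. -/
noncomputable def crColor {V : Type u} [Fintype V] (G : SimpleGraph V) :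
    (r : ℕ) → V → CRColor r
  | 0, _ => ()
  | r + 1, v => (crColor G r v,
      ((Finset.univ : Finset V).filter fun w => G.Adj v w).val.map (crColor G r))

/-- The multiset of the colors of all vertices after `r` rounds of color refinement. -/
noncomputable def crGraph (r : ℕ) {V : Type u} [Fintype V] (G : SimpleGraph V) :
    Multiset (CRColor r) :=
  (Finset.univ : Finset V).val.map (crColor G r)

/-- The `r`-round `k`-dimensional algorithm reports that `G` and `H` are isomorphic. The
one-dimensional algorithm is color refinement. -/
def WLReportsIso (k r : ℕ) {V U : Type u} [Fintype V] [Fintype U]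
    (G : SimpleGraph V) (H : SimpleGraph U) : Prop :=
  if k = 1 then crGraph r G = crGraph r H else wlGraph k r G = wlGraph k r H

/-- The count-free `r`-round `k`-dimensional algorithm (for `2 ≤ k`) reports that `G` and `H` are
isomorphic. -/
def CFReportsIso (k r : ℕ) {V U : Type u} (G : SimpleGraph V) (H : SimpleGraph U) : Prop :=
  cfGraph k r G = cfGraph k r H

/-- The output of the `r`-round `k`-dimensional algorithm is correct on all pairs `(G, H)`. -/
def WLWorksCorrectly (k r : ℕ) {V : Type u} [Fintype V] (G : SimpleGraph V) : Prop :=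
  ∀ (U : Type u) [Fintype U] [Nonempty U] (H : SimpleGraph U),
    WLReportsIso k r G H ↔ Nonempty (G ≃g H)

/-- The output of the count-free `r`-round `k`-dimensional algorithm is correct on all pairs
`(G, H)`. -/
def CFWorksCorrectly (k r : ℕ) {V : Type u} (G : SimpleGraph V) : Prop :=
  ∀ (U : Type u) [Fintype U] [Nonempty U] (H : SimpleGraph U),
    CFReportsIso k r G H ↔ Nonempty (G ≃g H)

end WLLogic

namespace WLLogic

universe u

open Function

/-! ### Matchings between two vertex sets -/

/-- The relation `P` contains a bijection (if `c` is true), or every element of either side is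
related to some element of the other side (if `c` is false). -/
def Matching (c : Bool) {A B : Type*} (P : A → B → Prop) : Prop :=
  match c with
  | true => ∃ e : A ≃ B, ∀ a, P a (e a)
  | false => (∀ a, ∃ b, P a b) ∧ ∀ b, ∃ a, P a b

section Matching

variable {c : Bool} {A B A' B' : Type*}

theorem Matching.mono {P Q : A → B → Prop} (h : Matching c P) (hPQ : ∀ a b, P a b → Q a b) :
    Matching c Q := by
  cases c with
  | true => exact h.imp fun e he a => hPQ _ _ (he a)
  | false =>
    exact ⟨fun a => (h.1 a).imp fun b => hPQ a b, fun b => (h.2 b).imp fun a => hPQ a b⟩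

theorem Matching.of_equiv {P : A → B → Prop} (e : A ≃ B) (he : ∀ a, P a (e a)) :
    Matching c P := by
  cases c with
  | true => exact ⟨e, he⟩
  | false => exact ⟨fun a => ⟨e a, he a⟩, fun b => ⟨e.symm b, by simpa using he (e.symm b)⟩⟩

theorem Matching.left {P : A → B → Prop} (h : Matching c P) (a : A) : ∃ b, P a b := by
  cases c with
  | true => obtain ⟨e, he⟩ := h; exact ⟨_, he a⟩
  | false => exact h.1 a

theorem Matching.right {P : A → B → Prop} (h : Matching c P) (b : B) : ∃ a, P a b := by
  cases c with
  | true => obtain ⟨e, he⟩ := h; exact ⟨e.symm b, by simpa using he (e.symm b)⟩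
  | false => exact h.2 b

theorem Matching.exists_iff {P : A → B → Prop} (h : Matching c P) {p : A → Prop} {q : B → Prop}
    (hpq : ∀ a b, P a b → (p a ↔ q b)) : (∃ a, p a) ↔ ∃ b, q b := by
  constructor
  · rintro ⟨a, ha⟩
    obtain ⟨b, hb⟩ := h.left a
    exact ⟨b, (hpq a b hb).1 ha⟩
  · rintro ⟨b, hb⟩
    obtain ⟨a, ha⟩ := h.right b
    exact ⟨a, (hpq a b ha).2 hb⟩

theorem Matching.forall_iff {P : A → B → Prop} (h : Matching c P) {p : A → Prop} {q : B → Prop}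
    (hpq : ∀ a b, P a b → (p a ↔ q b)) : (∀ a, p a) ↔ ∀ b, q b := by
  constructor
  · intro hp b
    obtain ⟨a, ha⟩ := h.right b
    exact (hpq a b ha).1 (hp a)
  · intro hq a
    obtain ⟨b, hb⟩ := h.left a
    exact (hpq a b hb).2 (hq b)

theorem Matching.exists_card_iff {P : A → B → Prop} (h : Matching true P) {p : A → Prop}
    {q : B → Prop} (hpq : ∀ a b, P a b → (p a ↔ q b)) (m : ℕ) :
    (∃ s : Finset A, s.card = m ∧ ∀ a ∈ s, p a) ↔
      ∃ s : Finset B, s.card = m ∧ ∀ b ∈ s, q b := by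
  obtain ⟨e, he⟩ := h
  constructor
  · rintro ⟨s, hs, hp⟩
    refine ⟨s.map e.toEmbedding, by simpa using hs, fun b hb => ?_⟩
    obtain ⟨a, ha, rfl⟩ := Finset.mem_map.1 hb
    exact (hpq _ _ (he a)).1 (hp a ha)
  · rintro ⟨s, hs, hq⟩
    refine ⟨s.map e.symm.toEmbedding, by simpa using hs, fun a ha => ?_⟩
    obtain ⟨b, hb, rfl⟩ := Finset.mem_map.1 ha
    exact (hpq _ _ (he _)).2 (by simpa using hq b hb)

/-- Matchings of the two coordinates combine to a matching of pairs. -/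
theorem Matching.prod {P : A → B → Prop} {Q : A × A' → B × B' → Prop} (h : Matching c P)
    (hQ : ∀ a b, P a b → Matching c fun a' b' => Q (a, a') (b, b')) : Matching c Q := by
  cases c with
  | true =>
    obtain ⟨e, he⟩ := h
    choose f hf using fun a => hQ a (e a) (he a)
    refine ⟨⟨fun x => (e x.1, f x.1 x.2), fun y => (e.symm y.1, (f (e.symm y.1)).symm y.2),
      fun x => by simp, fun y => by simp⟩, fun x => hf x.1 x.2⟩
  | false =>
    constructor
    · rintro ⟨a, a'⟩
      obtain ⟨b, hb⟩ := h.1 a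
      obtain ⟨b', hb'⟩ := (hQ a b hb).1 a'
      exact ⟨_, hb'⟩
    · rintro ⟨b, b'⟩
      obtain ⟨a, ha⟩ := h.2 b
      obtain ⟨a', ha'⟩ := (hQ a b ha).2 b'
      exact ⟨_, ha'⟩

theorem Matching.congr_equiv {P : A → B → Prop} (f : A' ≃ A) (g : B' ≃ B)
    (h : Matching c fun a b => P (f a) (g b)) : Matching c P := by
  cases c with
  | true =>
    obtain ⟨e, he⟩ := h
    exact ⟨(f.symm.trans e).trans g, fun a => by simpa using he (f.symm a)⟩
  | false =>
    constructor
    · intro a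
      obtain ⟨b, hb⟩ := h.1 (f.symm a)
      exact ⟨g b, by simpa using hb⟩
    · intro b
      obtain ⟨a, ha⟩ := h.2 (g.symm b)
      exact ⟨f a, by simpa using ha⟩

theorem matching_true_eq_iff [Fintype A] [Fintype B] {C : Type*} (f : A → C) (g : B → C) :
    Matching true (fun a b => f a = g b) ↔
      (Finset.univ : Finset A).val.map f = (Finset.univ : Finset B).val.map g := by
  have key : ∀ e : A ≃ B, (Finset.univ : Finset B).val.map g =
      (Finset.univ : Finset A).val.map (g ∘ e) := by
    intro e
    rw [← Finset.map_univ_equiv e, Finset.map_val, Multiset.map_map]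
    rfl
  constructor
  · rintro ⟨e, he⟩
    rw [key e]
    exact Multiset.map_congr rfl fun a _ => he a
  · intro h
    classical
    have hc : ∀ x : C, Nonempty ({a // f a = x} ≃ {b // g b = x}) := by
      intro x
      have hx := congrArg (Multiset.count x) h
      rw [Multiset.count_map, Multiset.count_map] at hx
      refine Fintype.card_eq.1 ?_
      rw [Fintype.card_subtype, Fintype.card_subtype]
      simp only [eq_comm (a := x)] at hx
      exact hx
    exact ⟨Equiv.ofFiberEquiv fun x => (hc x).some, fun a => (Equiv.ofFiberEquiv_map _ a).symm⟩

theorem matching_false_eq_iff {C : Type*} (f : A → C) (g : B → C) :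
    Matching false (fun a b => f a = g b) ↔ Set.range f = Set.range g := by
  constructor
  · rintro ⟨h₁, h₂⟩
    refine Set.Subset.antisymm ?_ ?_
    · rintro _ ⟨a, rfl⟩
      obtain ⟨b, hb⟩ := h₁ a
      exact ⟨b, hb.symm⟩
    · rintro _ ⟨b, rfl⟩
      obtain ⟨a, ha⟩ := h₂ b
      exact ⟨a, ha⟩
  · intro h
    refine ⟨fun a => ?_, fun b => ?_⟩
    · obtain ⟨b, hb⟩ : f a ∈ Set.range g := h ▸ Set.mem_range_self a
      exact ⟨b, hb.symm⟩
    · obtain ⟨a, ha⟩ : g b ∈ Set.range f := h ▸ Set.mem_range_self b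
      exact ⟨a, ha⟩

end Matching

/-! ### Truth of formulas and back-and-forth systems -/

/-- Membership in counting logic (if `c` is true) or in standard logic (if `c` is false). -/
def InLogic (c : Bool) (φ : Formula) : Prop := c = true ∨ φ.CountFree

theorem Formula.holds_congr {V : Type u} (G : SimpleGraph V) (φ : Formula) :
    ∀ s t : ℕ → V, (∀ i ∈ φ.freeVars, s i = t i) → (Formula.Holds G φ s ↔ Formula.Holds G φ t) := by
  have upd : ∀ (F : Finset ℕ) (i : ℕ) (s t : ℕ → V), (∀ l ∈ F.erase i, s l = t l) → ∀ w,
      ∀ l ∈ F, update s i w l = update t i w l := by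
    intro F i s t h w l hl
    by_cases hli : l = i
    · subst hli; simp
    · simpa [hli] using h l (Finset.mem_erase.2 ⟨hli, hl⟩)
  induction φ with
  | adj i j => intro s t h; simp [Formula.freeVars] at h; simp [Formula.Holds, h]
  | eq i j => intro s t h; simp [Formula.freeVars] at h; simp [Formula.Holds, h]
  | neg φ ih => intro s t h; exact not_congr (ih s t h)
  | and φ ψ ih₁ ih₂ =>
    intro s t h
    exact and_congr (ih₁ s t fun i hi => h i (Finset.mem_union_left _ hi))
      (ih₂ s t fun i hi => h i (Finset.mem_union_right _ hi))
  | or φ ψ ih₁ ih₂ =>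
    intro s t h
    exact or_congr (ih₁ s t fun i hi => h i (Finset.mem_union_left _ hi))
      (ih₂ s t fun i hi => h i (Finset.mem_union_right _ hi))
  | ex i φ ih => intro s t h; exact exists_congr fun w => ih _ _ (upd _ i s t h w)
  | all i φ ih => intro s t h; exact forall_congr' fun w => ih _ _ (upd _ i s t h w)
  | exAtLeast m i φ ih =>
    intro s t h
    exact exists_congr fun A => and_congr_right fun _ => forall₂_congr fun w _ =>
      ih _ _ (upd _ i s t h w)

/-- A back-and-forth system between `G` and `H` for assignments to the variables in `S`. -/
structure BackAndForth (c : Bool) (S : Finset ℕ) {V U : Type u} (G : SimpleGraph V)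
    (H : SimpleGraph U) (N : ℕ) (R : ℕ → (ℕ → V) → (ℕ → U) → Prop) : Prop where
  eq_iff : ∀ n s t, R n s t → ∀ i ∈ S, ∀ j ∈ S, (s i = s j ↔ t i = t j)
  adj_iff : ∀ n s t, R n s t → ∀ i ∈ S, ∀ j ∈ S, (G.Adj (s i) (s j) ↔ H.Adj (t i) (t j))
  step : ∀ n s t, n < N → R (n + 1) s t → ∀ j ∈ S,
    Matching c fun w w' => R n (update s j w) (update t j w')

section BackAndForth

variable {c : Bool} {S : Finset ℕ} {V U : Type u} {G : SimpleGraph V} {H : SimpleGraph U} {N : ℕ}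
  {R : ℕ → (ℕ → V) → (ℕ → U) → Prop}

theorem BackAndForth.holds_iff (hR : BackAndForth c S G H N R) (φ : Formula) :
    InLogic c φ → φ.vars ⊆ S → ∀ n s t, φ.depth ≤ n → n ≤ N → R n s t →
      (Formula.Holds G φ s ↔ Formula.Holds H φ t) := by
  induction φ with
  | adj i j =>
    intro _ hv n s t _ _ h
    exact hR.adj_iff n s t h i (hv (by simp [Formula.vars])) j (hv (by simp [Formula.vars]))
  | eq i j =>
    intro _ hv n s t _ _ h
    exact hR.eq_iff n s t h i (hv (by simp [Formula.vars])) j (hv (by simp [Formula.vars]))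
  | neg φ ih =>
    intro hc hv n s t hd hn h
    exact not_congr (ih hc hv n s t hd hn h)
  | and φ ψ ih₁ ih₂ =>
    intro hc hv n s t hd hn h
    exact and_congr
      (ih₁ (hc.imp_right And.left) (Finset.union_subset_left hv) n s t
        (le_trans (le_max_left _ _) hd) hn h)
      (ih₂ (hc.imp_right And.right) (Finset.union_subset_right hv) n s t
        (le_trans (le_max_right _ _) hd) hn h)
  | or φ ψ ih₁ ih₂ =>
    intro hc hv n s t hd hn h
    exact or_congr
      (ih₁ (hc.imp_right And.left) (Finset.union_subset_left hv) n s t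
        (le_trans (le_max_left _ _) hd) hn h)
      (ih₂ (hc.imp_right And.right) (Finset.union_subset_right hv) n s t
        (le_trans (le_max_right _ _) hd) hn h)
  | ex i φ ih =>
    intro hc hv n s t hd hn h
    obtain ⟨n, rfl⟩ := Nat.exists_eq_succ_of_ne_zero (Nat.ne_zero_of_lt hd)
    rw [Formula.vars, Finset.insert_subset_iff] at hv
    exact (hR.step n s t hn h i hv.1).exists_iff fun w w' hw =>
      ih hc hv.2 n _ _ (Nat.le_of_succ_le_succ hd) (Nat.le_of_succ_le hn) hw
  | all i φ ih =>
    intro hc hv n s t hd hn h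
    obtain ⟨n, rfl⟩ := Nat.exists_eq_succ_of_ne_zero (Nat.ne_zero_of_lt hd)
    rw [Formula.vars, Finset.insert_subset_iff] at hv
    exact (hR.step n s t hn h i hv.1).forall_iff fun w w' hw =>
      ih hc hv.2 n _ _ (Nat.le_of_succ_le_succ hd) (Nat.le_of_succ_le hn) hw
  | exAtLeast m i φ ih =>
    intro hc hv n s t hd hn h
    obtain ⟨n, rfl⟩ := Nat.exists_eq_succ_of_ne_zero (Nat.ne_zero_of_lt hd)
    rw [Formula.vars, Finset.insert_subset_iff] at hv
    obtain rfl : c = true := hc.resolve_right id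
    exact (hR.step n s t hn h i hv.1).exists_card_iff (fun w w' hw =>
      ih (Or.inl rfl) hv.2 n _ _ (Nat.le_of_succ_le_succ hd) (Nat.le_of_succ_le hn) hw) m

/-- A sentence of depth `N + 1` cannot distinguish two graphs whose constant assignments are
matched by a back-and-forth system with `N` rounds left. -/
theorem BackAndForth.sentence_iff (hR : BackAndForth c S G H N R)
    (hM : Matching c fun w w' => R N (fun _ => w) (fun _ => w')) (φ : Formula) :
    InLogic c φ → φ.vars ⊆ S → φ.depth ≤ N + 1 → φ.freeVars = ∅ → ∀ s t,
      (Formula.Holds G φ s ↔ Formula.Holds H φ t) := by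
  have const : ∀ {W : Type u} (K : SimpleGraph W) (φ : Formula) (i : ℕ) (s : ℕ → W) (w : W),
      φ.freeVars.erase i = ∅ →
        (Formula.Holds K φ (update s i w) ↔ Formula.Holds K φ fun _ => w) := by
    intro W K φ i s w h
    refine Formula.holds_congr K φ _ _ fun l hl => ?_
    obtain rfl : l = i := by
      by_contra hne
      exact Finset.notMem_empty l (h ▸ Finset.mem_erase.2 ⟨hne, hl⟩)
    simp
  have quant : ∀ (φ : Formula) (i : ℕ) (s : ℕ → V) (t : ℕ → U), InLogic c φ →
      insert i φ.vars ⊆ S → φ.depth + 1 ≤ N + 1 → φ.freeVars.erase i = ∅ → ∀ w w',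
      R N (fun _ => w) (fun _ => w') →
        (Formula.Holds G φ (update s i w) ↔ Formula.Holds H φ (update t i w')) := by
    intro φ i s t hc hv hd hf w w' hw
    rw [const G φ i s w hf, const H φ i t w' hf]
    exact hR.holds_iff φ hc (Finset.insert_subset_iff.1 hv).2 N _ _ (Nat.le_of_succ_le_succ hd)
      le_rfl hw
  induction φ with
  | adj i j => intro _ _ _ hf; simp [Formula.freeVars] at hf
  | eq i j => intro _ _ _ hf; simp [Formula.freeVars] at hf
  | neg φ ih => intro hc hv hd hf s t; exact not_congr (ih hc hv hd hf s t)
  | and φ ψ ih₁ ih₂ =>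
    intro hc hv hd hf s t
    rw [Formula.freeVars, Finset.union_eq_empty] at hf
    exact and_congr
      (ih₁ (hc.imp_right And.left) (Finset.union_subset_left hv)
        (le_trans (le_max_left _ _) hd) hf.1 s t)
      (ih₂ (hc.imp_right And.right) (Finset.union_subset_right hv)
        (le_trans (le_max_right _ _) hd) hf.2 s t)
  | or φ ψ ih₁ ih₂ =>
    intro hc hv hd hf s t
    rw [Formula.freeVars, Finset.union_eq_empty] at hf
    exact or_congr
      (ih₁ (hc.imp_right And.left) (Finset.union_subset_left hv)
        (le_trans (le_max_left _ _) hd) hf.1 s t)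
      (ih₂ (hc.imp_right And.right) (Finset.union_subset_right hv)
        (le_trans (le_max_right _ _) hd) hf.2 s t)
  | ex i φ ih => intro hc hv hd hf s t; exact hM.exists_iff (quant φ i s t hc hv hd hf)
  | all i φ ih => intro hc hv hd hf s t; exact hM.forall_iff (quant φ i s t hc hv hd hf)
  | exAtLeast m i φ ih =>
    intro hc hv hd hf s t
    obtain rfl : c = true := hc.resolve_right id
    exact hM.exists_card_iff (quant φ i s t (Or.inl rfl) hv hd hf) m

end BackAndForth

/-! ### Formulas that describe matchings -/

/-- `φ` belongs to the logic given by `c`, its variables lie in `S`, its free variables in `F`, and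
its depth is at most `d`. -/
structure Admissible (c : Bool) (S F : Finset ℕ) (d : ℕ) (φ : Formula) : Prop where
  inLogic : InLogic c φ
  vars_subset : φ.vars ⊆ S
  freeVars_subset : φ.freeVars ⊆ F
  depth_le : φ.depth ≤ d

section Admissible

variable {c : Bool} {S F : Finset ℕ} {d : ℕ} {φ ψ : Formula}

theorem Admissible.mono {F' : Finset ℕ} {d' : ℕ} (h : Admissible c S F d φ) (hF : F ⊆ F')
    (hd : d ≤ d') : Admissible c S F' d' φ :=
  ⟨h.1, h.2, h.3.trans hF, h.4.trans hd⟩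

theorem admissible_adj {i j : ℕ} (hi : i ∈ S) (hj : j ∈ S) (hi' : i ∈ F) (hj' : j ∈ F) :
    Admissible c S F d (.adj i j) :=
  ⟨Or.inr trivial, by simp [Formula.vars, Finset.insert_subset_iff, *],
    by simp [Formula.freeVars, Finset.insert_subset_iff, *], by simp [Formula.depth]⟩

theorem admissible_eq {i j : ℕ} (hi : i ∈ S) (hj : j ∈ S) (hi' : i ∈ F) (hj' : j ∈ F) :
    Admissible c S F d (.eq i j) :=
  ⟨Or.inr trivial, by simp [Formula.vars, Finset.insert_subset_iff, *],
    by simp [Formula.freeVars, Finset.insert_subset_iff, *], by simp [Formula.depth]⟩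

theorem Admissible.neg (h : Admissible c S F d φ) : Admissible c S F d φ.neg :=
  ⟨h.1, h.2, h.3, h.4⟩

theorem Admissible.and (h : Admissible c S F d φ) (h' : Admissible c S F d ψ) :
    Admissible c S F d (φ.and ψ) :=
  ⟨h.1.elim Or.inl fun a => h'.1.imp_right fun b => ⟨a, b⟩, Finset.union_subset h.2 h'.2,
    Finset.union_subset h.3 h'.3, max_le h.4 h'.4⟩

theorem Admissible.or (h : Admissible c S F d φ) (h' : Admissible c S F d ψ) :
    Admissible c S F d (φ.or ψ) :=
  ⟨h.1.elim Or.inl fun a => h'.1.imp_right fun b => ⟨a, b⟩, Finset.union_subset h.2 h'.2,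
    Finset.union_subset h.3 h'.3, max_le h.4 h'.4⟩

theorem Admissible.ex {j : ℕ} (hj : j ∈ S) (h : Admissible c S F d φ) :
    Admissible c S (F.erase j) (d + 1) (φ.ex j) :=
  ⟨h.1, Finset.insert_subset hj h.2, Finset.erase_subset_erase j h.3, Nat.succ_le_succ h.4⟩

theorem Admissible.all {j : ℕ} (hj : j ∈ S) (h : Admissible c S F d φ) :
    Admissible c S (F.erase j) (d + 1) (φ.all j) :=
  ⟨h.1, Finset.insert_subset hj h.2, Finset.erase_subset_erase j h.3, Nat.succ_le_succ h.4⟩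

theorem Admissible.exAtLeast {j : ℕ} (m : ℕ) (hj : j ∈ S) (h : Admissible true S F d φ) :
    Admissible true S (F.erase j) (d + 1) (φ.exAtLeast m j) :=
  ⟨Or.inl rfl, Finset.insert_subset hj h.2, Finset.erase_subset_erase j h.3, Nat.succ_le_succ h.4⟩

/-- The literal `φ` or `¬ φ`, according to the truth value of `p`. -/
theorem exists_literal (p : Prop) (h : Admissible c S F d φ) :
    ∃ ψ, Admissible c S F d ψ ∧ ∀ {U : Type u} (H : SimpleGraph U) (t : ℕ → U),
      Formula.Holds H ψ t ↔ (p ↔ Formula.Holds H φ t) := by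
  by_cases hp : p
  · exact ⟨φ, h, fun H t => by simp [hp]⟩
  · exact ⟨φ.neg, h.neg, fun H t => by simp [hp, Formula.Holds]⟩

theorem exists_conjunction {ι : Type*} {A : Finset ι} (hA : A.Nonempty) {χ : ι → Formula}
    (hχ : ∀ i, Admissible c S F d (χ i)) :
    ∃ ψ, Admissible c S F d ψ ∧ ∀ {U : Type u} (H : SimpleGraph U) (t : ℕ → U),
      Formula.Holds H ψ t ↔ ∀ i ∈ A, Formula.Holds H (χ i) t := by
  induction hA using Finset.Nonempty.cons_induction with
  | singleton a => exact ⟨χ a, hχ a, by simp⟩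
  | cons a s ha hs ih =>
    obtain ⟨ψ, h₁, h₂⟩ := ih
    exact ⟨(χ a).and ψ, (hχ a).and h₁, fun H t => by simp [Formula.Holds, h₂]⟩

theorem exists_disjunction {ι : Type*} {A : Finset ι} (hA : A.Nonempty) {χ : ι → Formula}
    (hχ : ∀ i, Admissible c S F d (χ i)) :
    ∃ ψ, Admissible c S F d ψ ∧ ∀ {U : Type u} (H : SimpleGraph U) (t : ℕ → U),
      Formula.Holds H ψ t ↔ ∃ i ∈ A, Formula.Holds H (χ i) t := by
  induction hA using Finset.Nonempty.cons_induction with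
  | singleton a => exact ⟨χ a, hχ a, by simp⟩
  | cons a s ha hs ih =>
    obtain ⟨ψ, h₁, h₂⟩ := ih
    exact ⟨(χ a).or ψ, (hχ a).or h₁, fun H t => by simp [Formula.Holds, h₂]⟩

/-- If the formulas `χ w` describe the vertices `w` of `G`, then one more quantifier suffices to
state that the vertices of a graph can be matched with those of `G` in accordance with `χ`. -/
theorem exists_matching_formula {V : Type u} [Fintype V] [Nonempty V] (G : SimpleGraph V) {j : ℕ}
    (hj : j ∈ S) {χ : V → Formula} (hχ : ∀ w, Admissible c S F d (χ w)) :
    ∃ Φ, Admissible c S (F.erase j) (d + 1) Φ ∧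
      (∀ s : ℕ → V, (∀ w, Formula.Holds G (χ w) (update s j w)) → Formula.Holds G Φ s) ∧
      ∀ (U : Type u) [Fintype U] (H : SimpleGraph U) (t : ℕ → U), Formula.Holds H Φ t →
        Matching c fun w w' => Formula.Holds H (χ w) (update t j w') := by
  classical
  cases c with
  | false =>
    obtain ⟨δ, hδ, hδ'⟩ := exists_disjunction.{u} Finset.univ_nonempty hχ
    obtain ⟨κ, hκ, hκ'⟩ := exists_conjunction.{u} Finset.univ_nonempty fun w => (hχ w).ex hj
    refine ⟨κ.and (δ.all j), hκ.and (hδ.all hj), fun s hs => ⟨?_, fun w => ?_⟩, ?_⟩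
    · exact (hκ' G s).2 fun w _ => ⟨w, hs w⟩
    · exact (hδ' G _).2 ⟨w, Finset.mem_univ w, hs w⟩
    · rintro U _ H t ⟨h₁, h₂⟩
      refine ⟨fun w => (hκ' H t).1 h₁ w (Finset.mem_univ w), fun w' => ?_⟩
      obtain ⟨w, -, hw⟩ := (hδ' H _).1 (h₂ w')
      exact ⟨w, hw⟩
  | true =>
    choose δ hδ hδ' using fun A : {A : Finset V // A.Nonempty} =>
      exists_disjunction.{u} A.2 hχ
    have : Nonempty {A : Finset V // A.Nonempty} := ⟨⟨Finset.univ, Finset.univ_nonempty⟩⟩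
    obtain ⟨κ, hκ, hκ'⟩ := exists_conjunction.{u} Finset.univ_nonempty
      fun A => (hδ A).exAtLeast A.1.card hj
    have htop : Admissible true S ({j} : Finset ℕ) d (.eq j j) :=
      admissible_eq hj hj (by simp) (by simp)
    refine ⟨κ.and (Formula.exAtLeast (Fintype.card V + 1) j (.eq j j)).neg,
      hκ.and ((htop.exAtLeast _ hj).neg.mono (by simp) le_rfl), fun s hs => ⟨?_, ?_⟩, ?_⟩
    · refine (hκ' G s).2 fun A _ => ⟨A.1, rfl, fun w hw => (hδ' A G _).2 ⟨w, hw, hs w⟩⟩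
    · rintro ⟨A, hA, -⟩
      have := A.card_le_univ
      omega
    · rintro U _ H t ⟨h₁, h₂⟩
      have hU : Fintype.card U ≤ Fintype.card V := by
        by_contra hlt
        obtain ⟨A, -, hA⟩ := Finset.exists_subset_card_eq
          (s := (Finset.univ : Finset U)) (n := Fintype.card V + 1)
          (by rw [Finset.card_univ]; omega)
        exact h₂ ⟨A, hA, fun w _ => rfl⟩
      obtain ⟨f, hf, hf'⟩ := (Fintype.all_card_le_filter_rel_iff_exists_injective
        fun (w : V) (w' : U) => Formula.Holds H (χ w) (update t j w')).1 (by
          intro A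
          rcases A.eq_empty_or_nonempty with rfl | hA
          · simp
          · obtain ⟨B, hB, hB'⟩ := (hκ' H t).1 h₁ ⟨A, hA⟩ (Finset.mem_univ _)
            simp only at hB
            rw [← hB]
            refine Finset.card_le_card fun w' hw' => ?_
            simpa using (hδ' ⟨A, hA⟩ H _).1 (hB' w' hw'))
      have hbij : Bijective f := (Fintype.bijective_iff_injective_and_card f).2
        ⟨hf, le_antisymm (Fintype.card_le_of_injective f hf) hU⟩
      exact ⟨Equiv.ofBijective f hbij, hf'⟩

end Admissible

/-! ### Graph parameters and defining sentences -/

/-- The logic given by `c`: counting logic or standard logic. -/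
def logic (c : Bool) : Set Formula := {φ | InLogic c φ}

theorem logic_true : logic true = countingLogic := by
  ext φ; simp [logic, InLogic, countingLogic]

theorem logic_false : logic false = standardLogic := by
  ext φ; simp [logic, InLogic, standardLogic]

theorem exists_of_logicalDepth_le {L : Set Formula} {l n : ℕ} {V : Type u} {G : SimpleGraph V}
    (h : logicalDepth L l G ≤ (n : ℕ∞)) :
    ∃ φ ∈ L, φ.width ≤ l ∧ φ.Defines G ∧ φ.depth ≤ n := by
  have h' : logicalDepth L l G < ((n + 1 : ℕ) : ℕ∞) :=
    lt_of_le_of_lt h (by exact_mod_cast Nat.lt_succ_self n)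
  simp only [logicalDepth, iInf_lt_iff] at h'
  obtain ⟨φ, ⟨h₁, h₂, h₃⟩, h₄⟩ := h'
  exact ⟨φ, h₁, h₂, h₃, Nat.lt_succ_iff.1 (by exact_mod_cast h₄)⟩

theorem logicalWidth_le_and_logicalDepth_le {L : Set Formula} {l n : ℕ} {V : Type u}
    {G : SimpleGraph V} {φ : Formula} (hL : φ ∈ L) (hw : φ.width ≤ l) (hd : φ.depth ≤ n)
    (hφ : φ.Defines G) :
    logicalWidth L G ≤ (l : ℕ∞) ∧ logicalDepth L l G ≤ (n : ℕ∞) :=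
  ⟨(iInf₂_le φ ⟨hL, hφ⟩).trans (by exact_mod_cast hw),
    (iInf₂_le φ ⟨hL, hw, hφ⟩).trans (by exact_mod_cast hd)⟩

/-- A sentence that holds on `G` only together with all graphs isomorphic to `G` bounds width and
depth. -/
theorem logical_bounds_of_sentence {c : Bool} {k n : ℕ} {V : Type u} {G : SimpleGraph V}
    {φ : Formula} (hφ : Admissible c (Finset.range (k + 1)) ∅ n φ) (hG : ∀ s, Formula.Holds G φ s)
    (hH : ∀ (U : Type u) [Fintype U] [Nonempty U] (H : SimpleGraph U) (t : ℕ → U),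
      Formula.Holds H φ t → Nonempty (G ≃g H)) :
    logicalWidth (logic c) G ≤ (k : ℕ∞) + 1 ∧ logicalDepth (logic c) (k + 1) G ≤ (n : ℕ∞) := by
  have := logicalWidth_le_and_logicalDepth_le (L := logic c) (l := k + 1) (n := n) (G := G)
    (φ := φ) hφ.inLogic (by simpa [Formula.width] using Finset.card_le_card hφ.vars_subset) hφ.depth_le
    ⟨Finset.subset_empty.1 hφ.freeVars_subset, hG, fun U _ _ H hn hT =>
      hn (hH U H (fun _ => Classical.arbitrary U) (hT _))⟩
  simpa using this

/-- Graphs that agree on the sentences of small width and depth are isomorphic to `G`. -/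
theorem nonempty_iso_of_logicalDepth_le {c : Bool} {l n : ℕ} {V U : Type u} [Nonempty V]
    [Fintype U] [Nonempty U] {G : SimpleGraph V} {H : SimpleGraph U}
    (h : logicalDepth (logic c) l G ≤ (n : ℕ∞))
    (hGH : ∀ φ : Formula, InLogic c φ → φ.width ≤ l → φ.depth ≤ n → φ.freeVars = ∅ →
      ∀ s t, (Formula.Holds G φ s ↔ Formula.Holds H φ t)) : Nonempty (G ≃g H) := by
  obtain ⟨φ, h₁, h₂, ⟨h₃, h₄, h₅⟩, h₆⟩ := exists_of_logicalDepth_le h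
  by_contra hn
  exact h₅ U H hn fun t =>
    (hGH φ h₁ h₂ h₆ h₃ (fun _ => Classical.arbitrary V) t).1 (h₄ _)

/-! ### The algorithm of dimension at least two -/

/-- The tuples `x` and `y` get the same color in `r` rounds, of the counting version if `c` is true
and of the count-free version if `c` is false. -/
def WLEq (c : Bool) {k : ℕ} {V U : Type u} (G : SimpleGraph V) (H : SimpleGraph U) :
    ℕ → (Fin k → V) → (Fin k → U) → Prop
  | 0, x, y => isoType G x = isoType H y
  | r + 1, x, y => WLEq c G H r x y ∧
      Matching c fun w w' => ∀ i, WLEq c G H r (update x i w) (update y i w')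

section WLEq

variable {c : Bool} {k : ℕ} {V U : Type u} {G : SimpleGraph V} {H : SimpleGraph U}

theorem wlColor_eq_iff [Fintype V] [Fintype U] (r : ℕ) (x : Fin k → V) (y : Fin k → U) :
    wlColor G r x = wlColor H r y ↔ WLEq true G H r x y := by
  induction r generalizing x y with
  | zero => rfl
  | succ r ih =>
    refine Prod.mk.injEq .. ▸ and_congr (ih x y) ?_
    rw [← matching_true_eq_iff]
    simp only [funext_iff, ih]

theorem cfColor_eq_iff (r : ℕ) (x : Fin k → V) (y : Fin k → U) :
    cfColor G r x = cfColor H r y ↔ WLEq false G H r x y := by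
  induction r generalizing x y with
  | zero => rfl
  | succ r ih =>
    refine Prod.mk.injEq .. ▸ and_congr (ih x y) ?_
    rw [← matching_false_eq_iff]
    simp only [funext_iff, ih]

theorem wlGraph_eq_iff [Fintype V] [Fintype U] (r : ℕ) :
    wlGraph k r G = wlGraph k r H ↔
      Matching true fun (x : Fin k → V) (y : Fin k → U) => WLEq true G H r x y := by
  simp only [← wlColor_eq_iff, matching_true_eq_iff, wlGraph]

theorem cfGraph_eq_iff (r : ℕ) :
    cfGraph k r G = cfGraph k r H ↔
      Matching false fun (x : Fin k → V) (y : Fin k → U) => WLEq false G H r x y := by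
  simp only [← cfColor_eq_iff, matching_false_eq_iff, cfGraph]

theorem isoType_eq_iff (x : Fin k → V) (y : Fin k → U) :
    isoType G x = isoType H y ↔
      ∀ i j, (x i = x j ↔ y i = y j) ∧ (G.Adj (x i) (x j) ↔ H.Adj (y i) (y j)) := by
  simp only [isoType, Prod.mk.injEq, Set.ext_iff, Set.mem_ofPred_eq, Prod.forall]
  exact ⟨fun h i j => ⟨h.1 i j, h.2 i j⟩, fun h => ⟨fun i j => (h i j).1, fun i j => (h i j).2⟩⟩

theorem WLEq.isoType_eq {r : ℕ} {x : Fin k → V} {y : Fin k → U} (h : WLEq c G H r x y) :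
    isoType G x = isoType H y := by
  induction r with
  | zero => exact h
  | succ r ih => exact ih h.1

theorem WLEq.of_iso (e : G ≃g H) (r : ℕ) (x : Fin k → V) : WLEq c G H r x (e ∘ x) := by
  induction r generalizing x with
  | zero => exact (isoType_eq_iff _ _).2 fun i j => by simp [e.map_adj_iff]
  | succ r ih =>
    refine ⟨ih x, Matching.of_equiv e.toEquiv fun w i => ?_⟩
    have := ih (update x i w)
    rwa [comp_update] at this

theorem update_comp_of_notMem {W : Type u} (x : Fin k → W) (σ : Fin k → Fin k) {i l : Fin k}
    (hl : ∀ i', i' ≠ i → σ i' ≠ l) (w : W) :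
    update (x ∘ σ) i w = update x l w ∘ update σ i l := by
  funext i'
  by_cases h : i' = i
  · subst h; simp
  · simp [h, hl i' h]

/-- Equality of colors is preserved by every substitution of coordinates. -/
theorem WLEq.comp {r : ℕ} {x : Fin k → V} {y : Fin k → U} (h : WLEq c G H r x y)
    (σ : Fin k → Fin k) : WLEq c G H r (x ∘ σ) (y ∘ σ) := by
  induction r generalizing x y σ with
  | zero =>
    refine (isoType_eq_iff _ _).2 fun i j => ?_
    exact (isoType_eq_iff _ _).1 (WLEq.isoType_eq h) (σ i) (σ j)
  | succ r ih =>
    refine ⟨ih h.1 σ, h.2.mono fun w w' hw i => ?_⟩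
    obtain ⟨l, hl⟩ : ∃ l, ∀ i', i' ≠ i → σ i' ≠ l := by
      by_contra hcon
      push Not at hcon
      have h₁ : (Finset.univ : Finset (Fin k)) ⊆ (Finset.univ.erase i).image σ := by
        intro l _
        obtain ⟨i', hi', hl⟩ := hcon l
        exact Finset.mem_image.2 ⟨i', by simp [hi'], hl⟩
      have h₂ := (Finset.card_le_card h₁).trans Finset.card_image_le
      rw [Finset.card_erase_of_mem (Finset.mem_univ i)] at h₂
      have h₃ : 0 < (Finset.univ : Finset (Fin k)).card := Finset.card_pos.2 ⟨i, Finset.mem_univ i⟩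
      omega
    rw [update_comp_of_notMem x σ hl, update_comp_of_notMem y σ hl]
    exact ih (hw l) _

/-- The assignments whose restrictions to `k` variables get equal colors. -/
theorem backAndForth_wlEq (hk : 2 ≤ k) {S : Finset ℕ} (hS : S.card ≤ k + 1) (N : ℕ) :
    BackAndForth c S G H N fun n s t =>
      ∀ f : Fin k → ℕ, (∀ i, f i ∈ S) → WLEq c G H n (s ∘ f) (t ∘ f) := by
  have atom : ∀ n (s : ℕ → V) (t : ℕ → U),
      (∀ f : Fin k → ℕ, (∀ i, f i ∈ S) → WLEq c G H n (s ∘ f) (t ∘ f)) → ∀ i ∈ S, ∀ j ∈ S,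
      (s i = s j ↔ t i = t j) ∧ (G.Adj (s i) (s j) ↔ H.Adj (t i) (t j)) := by
    intro n s t h i hi j hj
    have := (isoType_eq_iff _ _).1 (h (fun l => if l.1 = 0 then i else j)
      (fun l => by split_ifs <;> assumption)).isoType_eq ⟨0, by omega⟩ ⟨1, by omega⟩
    simpa using this
  refine ⟨fun n s t h i hi j hj => (atom n s t h i hi j hj).1,
    fun n s t h i hi j hj => (atom n s t h i hi j hj).2, fun n s t _ h j hj => ?_⟩
  obtain ⟨g, hg, hg'⟩ : ∃ g : Fin k → ℕ, (∀ i, g i ∈ S) ∧ ∀ m ∈ S.erase j, ∃ i, g i = m := by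
    have hcard : (S.erase j).card ≤ Fintype.card (Fin k) := by
      rw [Finset.card_erase_of_mem hj, Fintype.card_fin]; omega
    obtain ⟨ι⟩ : Nonempty ({m // m ∈ S.erase j} ↪ Fin k) :=
      Function.Embedding.nonempty_of_card_le (by simpa using hcard)
    classical
    refine ⟨fun i => if h : ∃ m, ι m = i then h.choose.1 else j, fun i => ?_, fun m hm => ?_⟩
    · dsimp only
      split_ifs with h
      · exact Finset.mem_of_mem_erase h.choose.2
      · exact hj
    · have hex : ∃ m', ι m' = ι ⟨m, hm⟩ := ⟨_, rfl⟩
      exact ⟨ι ⟨m, hm⟩, by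
        dsimp only
        rw [dif_pos hex, ι.injective hex.choose_spec]⟩
  have : Nonempty (Fin k) := ⟨⟨0, by omega⟩⟩
  choose! p hp using hg'
  refine (h g hg).2.mono fun w w' hw f hf => ?_
  by_cases hjf : ∃ i, f i = j
  · obtain ⟨i₀, hi₀⟩ := hjf
    obtain ⟨l, hl⟩ : ∃ l, ∀ i, f i ≠ j → p (f i) ≠ l := by
      by_contra hcon
      push Not at hcon
      have h₁ : (Finset.univ : Finset (Fin k)) ⊆ (Finset.univ.erase i₀).image fun i => p (f i) := by
        intro l _
        obtain ⟨i, hi, hl⟩ := hcon l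
        refine Finset.mem_image.2 ⟨i, ?_, hl⟩
        simp only [Finset.mem_erase, Finset.mem_univ, and_true]
        rintro rfl
        exact hi hi₀
      have h₂ := (Finset.card_le_card h₁).trans Finset.card_image_le
      rw [Finset.card_erase_of_mem (Finset.mem_univ i₀)] at h₂
      have h₃ : 0 < (Finset.univ : Finset (Fin k)).card := Finset.card_pos.2 ⟨i₀, Finset.mem_univ _⟩
      omega
    have key : ∀ {W : Type u} (s : ℕ → W) (w : W), update s j w ∘ f =
        update (s ∘ g) l w ∘ fun i => if f i = j then l else p (f i) := by
      intro W s w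
      funext i
      by_cases hi : f i = j
      · simp [hi]
      · simp [hi, hl i hi, hp (f i) (Finset.mem_erase.2 ⟨hi, hf i⟩)]
    rw [key, key]
    exact (hw l).comp _
  · push Not at hjf
    have key : ∀ {W : Type u} (s : ℕ → W) (w : W), update s j w ∘ f = s ∘ f := by
      intro W s w
      funext i
      simp [hjf i]
    rw [key, key]
    exact (h f hf).1

theorem Matching.const_of_wlEq (hk : 0 < k) {r : ℕ}
    (h : Matching c fun (x : Fin k → V) (y : Fin k → U) => WLEq c G H r x y) :
    Matching c fun (w : V) (w' : U) => WLEq c G H r (fun _ : Fin k => w) (fun _ => w') := by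
  have hr : ∀ (w : V) (y : Fin k → U), WLEq c G H r (fun _ => w) y →
      y = fun _ => y ⟨0, hk⟩ := fun w y hy => funext fun i =>
    ((isoType_eq_iff _ _).1 hy.isoType_eq i ⟨0, hk⟩).1.1 rfl
  have hl : ∀ (x : Fin k → V) (w' : U), WLEq c G H r x (fun _ => w') →
      x = fun _ => x ⟨0, hk⟩ := fun w y hy => funext fun i =>
    ((isoType_eq_iff _ _).1 hy.isoType_eq i ⟨0, hk⟩).1.2 rfl
  cases c with
  | true =>
    obtain ⟨e, he⟩ := h
    have he' : ∀ y, WLEq true G H r (e.symm y) y := fun y => by simpa using he (e.symm y)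
    refine ⟨⟨fun w => e (fun _ => w) ⟨0, hk⟩, fun w' => e.symm (fun _ => w') ⟨0, hk⟩,
      fun w => ?_, fun w' => ?_⟩, fun w => ?_⟩
    · dsimp only
      rw [← hr w _ (he _)]
      simp
    · dsimp only
      rw [← hl _ w' (he' _)]
      simp
    · dsimp only [Equiv.coe_fn_mk]
      rw [← hr w _ (he _)]
      exact he _
  | false =>
    refine ⟨fun w => ?_, fun w' => ?_⟩
    · obtain ⟨y, hy⟩ := h.1 fun _ => w
      exact ⟨y ⟨0, hk⟩, hr w y hy ▸ hy⟩
    · obtain ⟨x, hx⟩ := h.2 fun _ => w'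
      exact ⟨x ⟨0, hk⟩, hl x w' hx ▸ hx⟩

/-- Graphs that the algorithm does not distinguish agree on sentences. -/
theorem nonempty_iso_of_matching [Nonempty V] [Fintype U] [Nonempty U] (hk : 2 ≤ k) {r : ℕ}
    (hd : logicalDepth (logic c) (k + 1) G ≤ (r : ℕ∞) + 1)
    (h : Matching c fun (x : Fin k → V) (y : Fin k → U) => WLEq c G H r x y) :
    Nonempty (G ≃g H) := by
  refine nonempty_iso_of_logicalDepth_le (c := c) (l := k + 1) (n := r + 1) (by simpa using hd) ?_
  intro φ hφ hw hdφ hf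
  refine (backAndForth_wlEq hk (S := φ.vars) hw r).sentence_iff ?_ φ hφ subset_rfl hdφ hf
  exact (Matching.const_of_wlEq (by omega) h).mono fun w w' hww f _ => hww

end WLEq

/-! ### Defining sentences from the algorithm of dimension at least two -/

section Sentence

variable {V : Type u} [Fintype V] [Nonempty V]

/-- The color of a `k`-tuple of `G` is described by a formula with `k + 1` variables. -/
theorem exists_color_formula (c : Bool) {k : ℕ} (hk : 0 < k) (G : SimpleGraph V) (r : ℕ)
    (f : Fin k → ℕ) (hf : ∀ i, f i ∈ Finset.range (k + 1)) (x : Fin k → V) :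
    ∃ φ, Admissible c (Finset.range (k + 1)) (Finset.univ.image f) r φ ∧
      (∀ s : ℕ → V, s ∘ f = x → Formula.Holds G φ s) ∧
      ∀ (U : Type u) [Fintype U] (H : SimpleGraph U) (t : ℕ → U), Formula.Holds H φ t →
        WLEq c G H r x (t ∘ f) := by
  induction r generalizing f x with
  | zero =>
    have : Nonempty (Fin k) := ⟨⟨0, hk⟩⟩
    have hm : ∀ i, f i ∈ Finset.univ.image f := fun i => by simp
    choose α hα hα' using fun p : Fin k × Fin k => exists_literal.{u} (c := c) (d := 0)
      (x p.1 = x p.2) (admissible_eq (hf p.1) (hf p.2) (hm p.1) (hm p.2))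
    choose β hβ hβ' using fun p : Fin k × Fin k => exists_literal.{u} (c := c) (d := 0)
      (G.Adj (x p.1) (x p.2)) (admissible_adj (hf p.1) (hf p.2) (hm p.1) (hm p.2))
    obtain ⟨κ, hκ, hκ'⟩ := exists_conjunction.{u} Finset.univ_nonempty
      fun p => (hα p).and (hβ p)
    refine ⟨κ, hκ, ?_, ?_⟩
    · rintro s rfl
      exact (hκ' G s).2 fun p _ => ⟨(hα' p G s).2 Iff.rfl, (hβ' p G s).2 Iff.rfl⟩
    · intro U _ H t ht
      refine (isoType_eq_iff _ _).2 fun i j => ?_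
      have := (hκ' H t).1 ht (i, j) (Finset.mem_univ _)
      exact ⟨(hα' _ H t).1 this.1, (hβ' _ H t).1 this.2⟩
  | succ r ih =>
    have : Nonempty (Fin k) := ⟨⟨0, hk⟩⟩
    obtain ⟨j, hj, hjf⟩ : ∃ j ∈ Finset.range (k + 1), ∀ i, f i ≠ j := by
      by_contra hcon
      push Not at hcon
      have h₁ : Finset.range (k + 1) ⊆ Finset.univ.image f := by
        intro j hj
        obtain ⟨i, hi⟩ := hcon j hj
        exact Finset.mem_image.2 ⟨i, Finset.mem_univ i, hi⟩
      have h₂ := (Finset.card_le_card h₁).trans Finset.card_image_le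
      simp at h₂
    have hfu : ∀ i l, update f i j l ∈ Finset.range (k + 1) := by
      intro i l
      by_cases h : l = i
      · subst h; simpa using hj
      · simpa [h] using hf l
    have hupd : ∀ {W : Type u} (s : ℕ → W) (w : W) (i : Fin k),
        update s j w ∘ update f i j = update (s ∘ f) i w := by
      intro W s w i
      funext l
      by_cases h : l = i
      · subst h; simp
      · simp [h, hjf l]
    obtain ⟨φ, hφ, hφG, hφH⟩ := ih f hf x
    choose ξ hξ hξG hξH using fun (w : V) (i : Fin k) => ih (update f i j) (hfu i) (update x i w)
    have hξ' : ∀ w i, Admissible c (Finset.range (k + 1)) (insert j (Finset.univ.image f)) r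
        (ξ w i) := by
      refine fun w i => (hξ w i).mono ?_ le_rfl
      intro m hm
      obtain ⟨l, -, rfl⟩ := Finset.mem_image.1 hm
      by_cases h : l = i
      · subst h; simp
      · simp [h]
    choose χ hχ hχ' using fun w => exists_conjunction.{u} Finset.univ_nonempty (hξ' w)
    obtain ⟨Φ, hΦ, hΦG, hΦH⟩ := exists_matching_formula G hj hχ
    refine ⟨φ.and Φ, (hφ.mono subset_rfl (Nat.le_succ r)).and (hΦ.mono ?_ le_rfl), ?_, ?_⟩
    · exact Finset.erase_insert_subset j _
    · rintro s rfl
      refine ⟨hφG s rfl, hΦG s fun w => (hχ' w G _).2 fun i _ => hξG w i _ (hupd s w i)⟩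
    · rintro U _ H t ⟨h₁, h₂⟩
      refine ⟨hφH U H t h₁, (hΦH U H t h₂).mono fun w w' hw i => ?_⟩
      rw [← hupd t w' i]
      exact hξH w i U H _ ((hχ' w H _).1 hw i (Finset.mem_univ i))

/-- The assignment with the values `a` at the variables below `m`, and those of `s` elsewhere. -/
def patch {W : Type u} (s : ℕ → W) {m : ℕ} (a : Fin m → W) (n : ℕ) : W :=
  if h : n < m then a ⟨n, h⟩ else s n

theorem patch_update {W : Type u} (s : ℕ → W) {m : ℕ} (a : Fin m → W) (w : W) :
    patch (update s m w) a = patch s (Fin.snocEquiv (fun _ : Fin (m + 1) => W) (w, a)) := by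
  funext n
  rcases lt_trichotomy n m with h | rfl | h
  · have h' : n < m + 1 := by omega
    simp [patch, h, h', Fin.snocEquiv, Fin.snoc]
  · simp [patch, Fin.snocEquiv, Fin.snoc]
  · have h₁ : ¬ n < m := by omega
    have h₂ : ¬ n < m + 1 := by omega
    simp [patch, h₁, h₂, h.ne']

/-- Quantifying the first `m` variables one by one matches the `m`-tuples of the two graphs. -/
theorem exists_tuple_formula (c : Bool) {k : ℕ} (hk : 0 < k) (G : SimpleGraph V) (r m : ℕ)
    (hm : m ≤ k) (s : ℕ → V) :
    ∃ φ, Admissible c (Finset.range (k + 1)) (Finset.Ico m k) (r + m) φ ∧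
      Formula.Holds G φ s ∧
      ∀ (U : Type u) [Fintype U] (H : SimpleGraph U) (t : ℕ → U), Formula.Holds H φ t →
        Matching c fun (a : Fin m → V) (b : Fin m → U) =>
          WLEq c G H r (fun i : Fin k => patch s a i) (fun i => patch t b i) := by
  induction m generalizing s with
  | zero =>
    obtain ⟨φ, hφ, hφG, hφH⟩ := exists_color_formula c hk G r (fun i : Fin k => (i : ℕ))
      (fun i => by simp) (fun i => s i)
    refine ⟨φ, hφ.mono ?_ le_rfl, hφG s rfl, fun U _ H t ht => ?_⟩
    · intro n hn
      obtain ⟨i, -, rfl⟩ := Finset.mem_image.1 hn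
      simp
    · refine Matching.of_equiv (Equiv.ofUnique _ _) fun a => ?_
      simpa [patch, comp_def] using hφH U H t ht
  | succ m ih =>
    choose χ hχ hχG hχH using fun w => ih (by omega) (update s m w)
    obtain ⟨Φ, hΦ, hΦG, hΦH⟩ := exists_matching_formula G (j := m) (by simp; omega) hχ
    refine ⟨Φ, hΦ.mono ?_ le_rfl, hΦG s hχG, fun U _ H t ht => ?_⟩
    · intro n hn
      simp only [Finset.mem_erase, Finset.mem_Ico] at hn ⊢
      omega
    · refine Matching.congr_equiv (Fin.snocEquiv fun _ => V) (Fin.snocEquiv fun _ => U) ?_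
      refine (hΦH U H t ht).prod fun w w' hw => ?_
      simpa only [patch_update] using hχH w U H _ hw

/-- If the algorithm identifies `G`, then a sentence of small width and depth defines `G`. -/
theorem logical_bounds_of_matching (c : Bool) {k : ℕ} (hk : 0 < k) (G : SimpleGraph V) (r : ℕ)
    (h : ∀ (U : Type u) [Fintype U] [Nonempty U] (H : SimpleGraph U),
      (Matching c fun (x : Fin k → V) (y : Fin k → U) => WLEq c G H r x y) → Nonempty (G ≃g H)) :
    logicalWidth (logic c) G ≤ (k : ℕ∞) + 1 ∧
      logicalDepth (logic c) (k + 1) G ≤ (r : ℕ∞) + (k : ℕ∞) := by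
  obtain ⟨φ, hφ, hφG, hφH⟩ := exists_tuple_formula c hk G r k le_rfl
    (fun _ => Classical.arbitrary V)
  rw [Finset.Ico_self] at hφ
  have := logical_bounds_of_sentence (G := G) hφ
    (fun s => (Formula.holds_congr G φ _ _ fun i hi =>
      absurd (hφ.freeVars_subset hi) (Finset.notMem_empty i)).1 hφG)
    (fun U _ _ H t ht => h U H (by simpa [patch] using hφH U H t ht))
  simpa using this

end Sentence

/-! ### Color refinement -/

/-- The vertices `v` and `v'` are equivalent for `r` rounds of a version of color refinement that
also looks at the vertices that are not adjacent to the given one. -/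
def CREq {V U : Type u} (G : SimpleGraph V) (H : SimpleGraph U) : ℕ → V → U → Prop
  | 0, _, _ => True
  | r + 1, v, v' => CREq G H r v v' ∧ Matching true fun w w' =>
      (v = w ↔ v' = w') ∧ (G.Adj v w ↔ H.Adj v' w') ∧ CREq G H r w w'

section CREq

variable {V U : Type u} {G : SimpleGraph V} {H : SimpleGraph U}

theorem CREq.of_iso (e : G ≃g H) (r : ℕ) (v : V) : CREq G H r v (e v) := by
  induction r generalizing v with
  | zero => trivial
  | succ r ih => exact ⟨ih v, e.toEquiv, fun w => ⟨by simp, e.map_adj_iff.symm, ih w⟩⟩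

theorem backAndForth_crEq {S : Finset ℕ} (hS : S.card ≤ 2) (N : ℕ) :
    BackAndForth true S G H N fun n s t =>
      (∀ i ∈ S, ∀ j ∈ S, (s i = s j ↔ t i = t j) ∧ (G.Adj (s i) (s j) ↔ H.Adj (t i) (t j))) ∧
        ∀ i ∈ S, CREq G H n (s i) (t i) := by
  refine ⟨fun n s t h i hi j hj => (h.1 i hi j hj).1, fun n s t h i hi j hj => (h.1 i hi j hj).2,
    fun n s t _ h j hj => ?_⟩
  obtain ⟨i, hi, hij⟩ : ∃ i ∈ S, ∀ l ∈ S, l = i ∨ l = j := by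
    by_cases hex : ∃ i ∈ S, i ≠ j
    · obtain ⟨i, hi, hij⟩ := hex
      refine ⟨i, hi, fun l hl => ?_⟩
      by_contra hcon
      push Not at hcon
      have hsub : ({l, i, j} : Finset ℕ) ⊆ S := by
        simp [Finset.insert_subset_iff, hl, hi, hj]
      have hcard := Finset.card_le_card hsub
      rw [Finset.card_eq_three.2 ⟨l, i, j, hcon.1, hcon.2, hij, rfl⟩] at hcard
      omega
    · push Not at hex
      exact ⟨j, hj, fun l hl => Or.inl (hex l hl)⟩
  refine (h.2 i hi).2.mono fun w w' ⟨h₁, h₂, h₃⟩ => ?_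
  have h₀ := (h.2 i hi).1
  by_cases hne : i = j
  · subst hne
    have hS' : ∀ l ∈ S, l = i := fun l hl => (hij l hl).elim id id
    refine ⟨fun a ha b hb => ?_, fun a ha => ?_⟩
    · rw [hS' a ha, hS' b hb]; simp
    · rw [hS' a ha]; simpa using h₃
  · refine ⟨fun a ha b hb => ?_, fun a ha => ?_⟩
    · rcases hij a ha with rfl | rfl <;> rcases hij b hb with rfl | rfl
      · simp
      · simpa [hne] using ⟨h₁, h₂⟩
      · simp only [update_self, update_of_ne hne]
        rw [eq_comm, h₁, eq_comm, G.adj_comm, h₂, H.adj_comm]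
        exact ⟨Iff.rfl, Iff.rfl⟩
      · simp
    · rcases hij a ha with rfl | rfl
      · simpa [hne] using h₀
      · simpa using h₃

variable [Fintype V] [Fintype U]

theorem CREq.crColor_eq {r : ℕ} {v : V} {v' : U} (h : CREq G H r v v') :
    crColor G r v = crColor H r v' := by
  classical
  induction r generalizing v v' with
  | zero => rfl
  | succ r ih =>
    obtain ⟨h₁, e, he⟩ := h
    refine Prod.ext (ih h₁) ?_
    have hmap : (Finset.univ.filter fun w' => H.Adj v' w') =
        (Finset.univ.filter fun w => G.Adj v w).map e.toEmbedding := by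
      ext w'
      simp only [Finset.mem_filter, Finset.mem_univ, true_and, Finset.mem_map_equiv]
      simpa using (he (e.symm w')).2.1.symm
    dsimp only [crColor]
    rw [Finset.filter_congr_decidable, Finset.filter_congr_decidable, hmap, Finset.map_val,
      Multiset.map_map]
    exact Multiset.map_congr rfl fun w _ => ih (he w).2.2

theorem crGraph_eq_of_le {n r : ℕ} (hn : n ≤ r) (h : crGraph r G = crGraph r H) :
    crGraph n G = crGraph n H := by
  induction r, hn using Nat.le_induction with
  | base => exact h
  | succ r _ ih =>
    exact ih ((matching_true_eq_iff _ _).1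
      (((matching_true_eq_iff _ _).2 h).mono fun _ _ hw => congrArg Prod.fst hw))

open Classical in
theorem univ_val_eq_self_add_neighbors_add_rest (G : SimpleGraph V) (v : V) :
    (Finset.univ : Finset V).val = {v} + (Finset.univ.filter fun w => G.Adj v w).val +
      (Finset.univ.filter fun w => v ≠ w ∧ ¬ G.Adj v w).val := by
  ext w
  have hs : ∀ s : Finset V, s.val.count w = if w ∈ s then 1 else 0 := fun s =>
    Multiset.count_eq_of_nodup s.nodup
  simp only [Multiset.count_add, hs, Multiset.count_singleton, Finset.mem_univ, if_true,
    Finset.mem_filter, true_and]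
  by_cases h₁ : w = v
  · subst h₁; simp
  · have h₂ : v ≠ w := fun h => h₁ h.symm
    by_cases h₃ : G.Adj v w <;> simp [h₁, h₂, h₃]

theorem crEq_of_crColor_eq {n r : ℕ} (hr : crGraph r G = crGraph r H) (hn : n ≤ r + 1) {v : V}
    {v' : U} (h : crColor G n v = crColor H n v') : CREq G H n v v' := by
  classical
  induction n generalizing v v' with
  | zero => trivial
  | succ n ih =>
    have h₁ : crColor G n v = crColor H n v' := congrArg Prod.fst h
    have h₂ : ((Finset.univ : Finset V).filter fun w => G.Adj v w).val.map (crColor G n) =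
        ((Finset.univ : Finset U).filter fun w => H.Adj v' w).val.map (crColor H n) := 
      congrArg Prod.snd h
    have h₃ : crGraph n G = crGraph n H := crGraph_eq_of_le (by omega) hr
    refine ⟨ih (by omega) h₁, ?_⟩
    suffices hm : Matching true fun (w : V) (w' : U) =>
        (v = w, G.Adj v w, crColor G n w) = (v' = w', H.Adj v' w', crColor H n w') by
      refine hm.mono fun w w' hw => ?_
      simp only [Prod.mk.injEq] at hw
      exact ⟨iff_of_eq hw.1, iff_of_eq hw.2.1, ih (by omega) hw.2.2⟩
    rw [matching_true_eq_iff]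
    rw [crGraph, crGraph, univ_val_eq_self_add_neighbors_add_rest G v,
      univ_val_eq_self_add_neighbors_add_rest H v'] at h₃
    rw [univ_val_eq_self_add_neighbors_add_rest G v, univ_val_eq_self_add_neighbors_add_rest H v']
    simp only [Multiset.map_add, Multiset.map_singleton, h₁] at h₃ ⊢
    rw [h₂] at h₃
    have h₄ := add_left_cancel h₃
    have split : ∀ {W : Type u} [Fintype W] (K : SimpleGraph W) (x : W),
        ((Finset.univ.filter fun w => K.Adj x w).val.map
            (fun w => (x = w, K.Adj x w, crColor K n w)) =
          ((Finset.univ.filter fun w => K.Adj x w).val.map (crColor K n)).map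
            fun C => (False, True, C)) ∧
        ((Finset.univ.filter fun w => x ≠ w ∧ ¬ K.Adj x w).val.map
            (fun w => (x = w, K.Adj x w, crColor K n w)) =
          ((Finset.univ.filter fun w => x ≠ w ∧ ¬ K.Adj x w).val.map (crColor K n)).map
            fun C => (False, False, C)) := by
      intro W _ K x
      rw [Multiset.map_map, Multiset.map_map]
      refine ⟨Multiset.map_congr rfl fun w hw => ?_, Multiset.map_congr rfl fun w hw => ?_⟩
      · have hw : K.Adj x w := by simpa using hw
        simp [hw, hw.ne]
      · have hw : x ≠ w ∧ ¬ K.Adj x w := by simpa using hw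
        simp [hw.1, hw.2]
    rw [(split G v).1, (split G v).2, (split H v').1, (split H v').2, h₂, h₄]
    simp

theorem crGraph_eq_iff (r : ℕ) :
    crGraph r G = crGraph r H ↔ Matching true fun (w : V) (w' : U) => CREq G H r w w' := by
  constructor
  · intro h
    exact ((matching_true_eq_iff _ _).2 h).mono fun w w' hw => crEq_of_crColor_eq h (by omega) hw
  · exact fun h => (matching_true_eq_iff _ _).1 (h.mono fun w w' hw => hw.crColor_eq)

/-- Graphs that color refinement does not distinguish agree on sentences with two variables. -/
theorem nonempty_iso_of_crGraph_eq [Nonempty V] [Nonempty U] {r : ℕ}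
    (hd : logicalDepth (logic true) 2 G ≤ (r : ℕ∞) + 1) (h : crGraph r G = crGraph r H) :
    Nonempty (G ≃g H) := by
  refine nonempty_iso_of_logicalDepth_le (c := true) (l := 2) (n := r + 1) (by simpa using hd) ?_
  intro φ hφ hw hdφ hf
  refine (backAndForth_crEq (S := φ.vars) hw r).sentence_iff ?_ φ hφ subset_rfl hdφ hf
  exact ((crGraph_eq_iff r).1 h).mono fun w w' hww => ⟨by simp, fun _ _ => hww⟩

end CREq

section CRSentence

variable {V : Type u} [Fintype V] [Nonempty V]

/-- The color of a vertex of `G` is described by a formula with two variables. -/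
theorem exists_vertex_formula (G : SimpleGraph V) {S : Finset ℕ} (r : ℕ) {i j : ℕ} (hi : i ∈ S)
    (hj : j ∈ S) (hij : i ≠ j) (v : V) :
    ∃ φ, Admissible true S {i} r φ ∧ (∀ s : ℕ → V, s i = v → Formula.Holds G φ s) ∧
      ∀ (U : Type u) [Fintype U] (H : SimpleGraph U) (t : ℕ → U), Formula.Holds H φ t →
        CREq G H r v (t i) := by
  induction r generalizing i j v with
  | zero =>
    exact ⟨.eq i i, admissible_eq hi hi (by simp) (by simp), fun _ _ => rfl,
      fun _ _ _ _ _ => trivial⟩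
  | succ r ih =>
    obtain ⟨φ, hφ, hφG, hφH⟩ := ih hi hj hij v
    choose ξ hξ hξG hξH using fun w : V => ih hj hi hij.symm w
    have hmi : i ∈ ({i, j} : Finset ℕ) := by simp
    have hmj : j ∈ ({i, j} : Finset ℕ) := by simp
    choose α hα hα' using fun w : V => exists_literal.{u} (c := true) (d := r) (v = w)
      (admissible_eq hi hj hmi hmj)
    choose β hβ hβ' using fun w : V => exists_literal.{u} (c := true) (d := r) (G.Adj v w)
      (admissible_adj hi hj hmi hmj)
    obtain ⟨Φ, hΦ, hΦG, hΦH⟩ := exists_matching_formula G hj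
      fun w => (hα w).and ((hβ w).and ((hξ w).mono (by simp) le_rfl))
    refine ⟨φ.and Φ, (hφ.mono subset_rfl (Nat.le_succ r)).and (hΦ.mono ?_ le_rfl), ?_, ?_⟩
    · intro l hl
      simp only [Finset.mem_erase, Finset.mem_insert, Finset.mem_singleton] at hl ⊢
      tauto
    · rintro s rfl
      refine ⟨hφG s rfl, hΦG s fun w => ⟨(hα' w G _).2 ?_, (hβ' w G _).2 ?_, hξG w _ (by simp)⟩⟩
      · simp [Formula.Holds, hij]
      · simp [Formula.Holds, hij]
    · rintro U _ H t ⟨h₁, h₂⟩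
      refine ⟨hφH U H t h₁, (hΦH U H t h₂).mono fun w w' ⟨ha, hb, hc⟩ => ⟨?_, ?_, ?_⟩⟩
      · simpa [Formula.Holds, hij] using (hα' w H _).1 ha
      · simpa [Formula.Holds, hij] using (hβ' w H _).1 hb
      · simpa using hξH w U H _ hc

/-- If color refinement identifies `G`, then a sentence with two variables defines `G`. -/
theorem logical_bounds_of_crGraph (G : SimpleGraph V) (r : ℕ)
    (h : ∀ (U : Type u) [Fintype U] [Nonempty U] (H : SimpleGraph U),
      crGraph r G = crGraph r H → Nonempty (G ≃g H)) :
    logicalWidth (logic true) G ≤ ((1 : ℕ) : ℕ∞) + 1 ∧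
      logicalDepth (logic true) (1 + 1) G ≤ (r : ℕ∞) + ((1 : ℕ) : ℕ∞) := by
  have h0 : 0 ∈ Finset.range (1 + 1) := by simp
  have h1 : 1 ∈ Finset.range (1 + 1) := by simp
  choose χ hχ hχG hχH using exists_vertex_formula G r h0 h1 zero_ne_one
  obtain ⟨Φ, hΦ, hΦG, hΦH⟩ := exists_matching_formula G h0 hχ
  have := logical_bounds_of_sentence (G := G) (hΦ.mono (by simp) le_rfl)
    (fun s => hΦG s fun w => hχG w _ (by simp))
    (fun U _ _ H t ht => h U H ((crGraph_eq_iff r).2 ((hΦH U H t ht).mono fun w w' hw => by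
      simpa using hχH w U H _ hw)))
  simpa using this

end CRSentence

theorem crGraph_eq_of_iso {V U : Type u} [Fintype V] [Fintype U] {G : SimpleGraph V}
    {H : SimpleGraph U} (e : G ≃g H) (r : ℕ) : crGraph r G = crGraph r H :=
  (crGraph_eq_iff r).2 (Matching.of_equiv e.toEquiv (CREq.of_iso e r))

theorem matching_wlEq_of_iso {V U : Type u} {G : SimpleGraph V} {H : SimpleGraph U} (c : Bool)
    (k r : ℕ) (e : G ≃g H) :
    Matching c fun (x : Fin k → V) (y : Fin k → U) => WLEq c G H r x y :=
  Matching.of_equiv (Equiv.arrowCongr (Equiv.refl _) e.toEquiv) fun x => WLEq.of_iso e r x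

end WLLogic

theorem mainTheorem3 {V : Type*} [Fintype V] [Nonempty V] (G : SimpleGraph V) :
    (∀ k r : ℕ, 1 ≤ k →
      ((WLLogic.logicalWidth WLLogic.countingLogic G ≤ (k : ℕ∞) + 1 ∧
          WLLogic.logicalDepth WLLogic.countingLogic (k + 1) G ≤ (r : ℕ∞) + 1 →
        WLLogic.WLWorksCorrectly k r G) ∧
      (WLLogic.WLWorksCorrectly k r G →
        WLLogic.logicalWidth WLLogic.countingLogic G ≤ (k : ℕ∞) + 1 ∧
          WLLogic.logicalDepth WLLogic.countingLogic (k + 1) G ≤ (r : ℕ∞) + (k : ℕ∞)))) ∧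
    (∀ k r : ℕ, 2 ≤ k →
      ((WLLogic.logicalWidth WLLogic.standardLogic G ≤ (k : ℕ∞) + 1 ∧
          WLLogic.logicalDepth WLLogic.standardLogic (k + 1) G ≤ (r : ℕ∞) + 1 →
        WLLogic.CFWorksCorrectly k r G) ∧
      (WLLogic.CFWorksCorrectly k r G →
        WLLogic.logicalWidth WLLogic.standardLogic G ≤ (k : ℕ∞) + 1 ∧
          WLLogic.logicalDepth WLLogic.standardLogic (k + 1) G ≤ (r : ℕ∞) + (k : ℕ∞)))) := by
  rw [← WLLogic.logic_true, ← WLLogic.logic_false]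
  refine ⟨fun k r hk => ?_, fun k r hk => ⟨?_, ?_⟩⟩
  · by_cases hk1 : k = 1
    · subst hk1
      simp only [WLLogic.WLWorksCorrectly, WLLogic.WLReportsIso, if_true]
      refine ⟨fun h U _ _ H => ⟨WLLogic.nonempty_iso_of_crGraph_eq h.2, ?_⟩, fun h => ?_⟩
      · rintro ⟨e⟩
        exact WLLogic.crGraph_eq_of_iso e r
      · exact WLLogic.logical_bounds_of_crGraph G r fun U _ _ H => (h U H).1
    · simp only [WLLogic.WLWorksCorrectly, WLLogic.WLReportsIso, if_neg hk1,
        WLLogic.wlGraph_eq_iff]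
      refine ⟨fun h U _ _ H => ⟨WLLogic.nonempty_iso_of_matching (by omega) h.2, ?_⟩, fun h => ?_⟩
      · rintro ⟨e⟩
        exact WLLogic.matching_wlEq_of_iso true k r e
      · exact WLLogic.logical_bounds_of_matching true hk G r fun U _ _ H => (h U H).1
  · simp only [WLLogic.CFWorksCorrectly, WLLogic.CFReportsIso, WLLogic.cfGraph_eq_iff]
    refine fun h U _ _ H => ⟨WLLogic.nonempty_iso_of_matching hk h.2, ?_⟩
    rintro ⟨e⟩
    exact WLLogic.matching_wlEq_of_iso false k r e
  · simp only [WLLogic.CFWorksCorrectly, WLLogic.CFReportsIso, WLLogic.cfGraph_eq_iff]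
    exact fun h => WLLogic.logical_bounds_of_matching false (by omega) G r
      fun U _ _ H => (h U H).1
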